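/- Let $k\ge 2$ be an integer and $0<b<1$, and set $\sigma=\frac{b}{b+k-1}$. A treasure is hidden in a box of $\{1,\dots,M\}$, in box $x$ with probability $r_{M,b}(x)=x^{-b}/\sum_{y=1}^{M}y^{-b}$. At each time step $t=1,2,\dots$ each of $k$ searchers peeks into one box (or does nothing); the running time is the first step at which some searcher peeks into the box of the treasure, and $\mathbb T_M(A)\in[0,\infty]$ denotes its expectation under algorithm $A$, over the position of the treasure and the random choices of the searchers. An algorithm is *non-coordinating* if all searchers execute the same randomized protocol independently, i.e. the sequences of boxes peeked into by the $k$ searchers are independent and identically distributed (with an arbitrary common law). Let $\mathrm{cord}$ be the coordinated algorithm in which searcher $i\in\{1,\dots,k\}$ peeks into box $(t-1)k+i$ at step $t$. Let $\mathrm{pareto}_M$ be the non-coordinating algorithm in which each searcher, at step $t$, peeks into a uniformly random box among those in $\{1,\dots,\min(M,\lfloor t/\sigma\rfloor)\}$ that it has not itself checked yet (and stops when it has checked all $M$ boxes). Then $$\lim_{M\to\infty}\frac{\mathbb T_M(\mathrm{pareto}_M)}{\mathbb T_M(\mathrm{cord})}=k\sigma(2-\sigma)+\frac{k}{k+1}(2-b)(1-\sigma)^2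 .$$ Furthermore, no non-coordinating algorithm does better in the limit: for every sequence $(A_M)_{M\ge1}$ of non-coordinating algorithms for $k$ searchers (where $A_M$ may depend on $M$, $b$ and $k$), $$\liminf_{M\to\infty}\frac{\mathbb T_M(A_M)}{\mathbb T_M(\mathrm{cord})}\ \ge\ k\sigma(2-\sigma)+\frac{k}{k+1}(2-b)(1-\sigma)^2 .$$ -/

import Mathlib

open MeasureTheory Filter Topology
open scoped ENNReal

noncomputable section

namespace ParallelSearch

/-- The boxes are the positive integers. A run of one searcher is a sequence `w : ℕ → ℕ`, where
`w t` is the box peeked into at step `t + 1`; the value `0` is not a box and means that the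
searcher does nothing at that step. For `k` searchers with joint run `w`, `findTime x w` is the
first step at which some searcher peeks into box `x` (`∞` if this never happens). -/
def findTime {k : ℕ} (x : ℕ) (w : Fin k → ℕ → ℕ) : ℝ≥0∞ :=
  ⨅ (t : ℕ) (_ : ∃ i, w i t = x), ((t : ℝ≥0∞) + 1)

/-- The expected time until the first of the `k` searchers finds the treasure, when the treasure
is in box `x` with probability `p x` and `P` is the joint law of the runs of the searchers. -/
def expectedTime {k : ℕ} (p : ℕ → ℝ≥0∞) (P : Measure (Fin k → ℕ → ℕ)) : ℝ≥0∞ :=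
  ∑' x : ℕ, p x * ∫⁻ w, findTime x w ∂P

/-- A non-coordinating algorithm is given by the law `A` of the run of a single searcher; the `k`
searchers run it independently. -/
def nonCoordinating (k : ℕ) (A : Measure (ℕ → ℕ)) : Measure (Fin k → ℕ → ℕ) :=
  Measure.pi fun _ => A

/-- The fully coordinated algorithm: searcher `i ∈ {1, …, k}` peeks into box `(t - 1) k + i` at
step `t ≥ 1` (in the indexing below both `i` and `t` start at `0`). -/
def cord (k : ℕ) : Measure (Fin k → ℕ → ℕ) :=
  Measure.dirac fun i t => t * k + (i : ℕ) + 1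

/-- The Pareto distribution with parameter `b` on the boxes `1, …, M`. -/
def paretoDist (M : ℕ) (b : ℝ) (x : ℕ) : ℝ≥0∞ :=
  if x ∈ Finset.Icc 1 M then
    ENNReal.ofReal ((1 / (x : ℝ) ^ b) / ∑ y ∈ Finset.Icc 1 M, 1 / (y : ℝ) ^ b)
  else 0

/-- The boxes in `{1, …, min(M, ⌊t/σ⌋)}` that a searcher with run `w` has not checked in its
steps `1, …, t - 1`. -/
def unchecked (σ : ℝ) (M : ℕ) (w : ℕ → ℕ) (t : ℕ) : Finset ℕ :=
  Finset.Icc 1 (min M ⌊(t : ℝ) / σ⌋₊) \ (Finset.range (t - 1)).image w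

open Classical in
/-- A uniformly random element of `s`; if `s` is empty, the value `0` (do nothing). -/
def uniformChoice (s : Finset ℕ) : PMF ℕ :=
  if hs : s.Nonempty then PMF.uniformOfFinset s hs else PMF.pure 0

/-- The random run of a searcher executing the first `n` steps of the algorithm that at step `t`
peeks into a uniformly random unchecked box of `{1, …, min(M, ⌊t/σ⌋)}`, and then stops. -/
def paretoRun (σ : ℝ) (M : ℕ) : ℕ → PMF (ℕ → ℕ)
  | 0 => PMF.pure fun _ => 0
  | n + 1 => (paretoRun σ M n).bind fun w =>
      (uniformChoice (unchecked σ M w (n + 1))).map fun x => Function.update w n x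

/-- The law of a searcher's run in the algorithm above. For `0 < σ ≤ 1` each of the first `M`
steps checks a new box, so after `M` steps no unchecked box is left. -/
def paretoAlg (σ : ℝ) (M : ℕ) : Measure (ℕ → ℕ) :=
  (paretoRun σ M M).toMeasure

end ParallelSearch

end

/-!
The expected time is a sum over steps: `∑ t, ∑ x, p x * q x t ^ k`, where `q x t` is the
probability that a single searcher misses box `x` in its first `t` steps. A searcher checks at most
one box per step, so `∑ x ∈ Icc 1 M, (1 - q x t) ≤ t`, and at each time `t` one is left with the
convex problem of minimizing `∑ x, x ^ (-b) * q x ^ k` under this budget. With `a = b / (k - 1)`,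
the Lagrange condition makes `q x` proportional to `x ^ a`, truncated at `1`. For `t < σ * M` the
solution is `min 1 (σ * x / t) ^ a`, where `σ = a / (1 + a)` balances the budget; for later `t` it
is `c * x ^ a` over all the boxes.

These optimal profiles do not depend on the step structure, yet one searcher can realize all of them
at once: under the Pareto algorithm the probability of missing a box satisfies a recurrence whose
solution is the same profile up to lower order terms. Asymptotics of power sums then give the same
limit for the lower and the upper bound.
-/

noncomputable section

namespace ParallelSearch

/-! ### Sequences growing like a power -/

/-- `f n ∼ L * n ^ q` as `n → ∞`, in the sense that the quotient by `n ^ q` tends to `L`; the value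
`L = 0` is allowed and then means `f n = o(n ^ q)`. -/
def HasPowerGrowth (f : ℕ → ℝ) (q L : ℝ) : Prop :=
  Tendsto (fun n : ℕ => f n / (n : ℝ) ^ q) atTop (𝓝 L)

lemma eventually_natCast_pos : ∀ᶠ n : ℕ in atTop, (0 : ℝ) < n := by
  filter_upwards [eventually_gt_atTop 0] with n hn
  exact_mod_cast hn

lemma hasPowerGrowth_rpow (q : ℝ) : HasPowerGrowth (fun n => (n : ℝ) ^ q) q 1 := by
  refine tendsto_const_nhds.congr' ?_
  filter_upwards [eventually_natCast_pos] with n hn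
  exact (div_self (Real.rpow_pos_of_pos hn q).ne').symm

lemma hasPowerGrowth_const (c : ℝ) : HasPowerGrowth (fun _ => c) 0 c := by
  simp [HasPowerGrowth]

lemma hasPowerGrowth_natCast : HasPowerGrowth (fun n => (n : ℝ)) 1 1 := by
  simpa using hasPowerGrowth_rpow 1

namespace HasPowerGrowth

variable {f g : ℕ → ℝ} {p q L K : ℝ}

lemma congr' (hf : HasPowerGrowth f q L) (h : f =ᶠ[atTop] g) : HasPowerGrowth g q L := by
  refine Tendsto.congr' ?_ hf
  filter_upwards [h] with n hn
  rw [hn]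

lemma add (hf : HasPowerGrowth f q L) (hg : HasPowerGrowth g q K) :
    HasPowerGrowth (fun n => f n + g n) q (L + K) := by
  simpa only [HasPowerGrowth, add_div] using Tendsto.add hf hg

lemma sub (hf : HasPowerGrowth f q L) (hg : HasPowerGrowth g q K) :
    HasPowerGrowth (fun n => f n - g n) q (L - K) := by
  simpa only [HasPowerGrowth, sub_div] using Tendsto.sub hf hg

lemma mul (hf : HasPowerGrowth f p L) (hg : HasPowerGrowth g q K) :
    HasPowerGrowth (fun n => f n * g n) (p + q) (L * K) := by
  refine (Tendsto.mul hf hg).congr' ?_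
  filter_upwards [eventually_natCast_pos] with n hn
  rw [Real.rpow_add hn, div_mul_div_comm]

lemma const_mul (c : ℝ) (hf : HasPowerGrowth f q L) :
    HasPowerGrowth (fun n => c * f n) q (c * L) := by
  simpa using (hasPowerGrowth_const c).mul hf

lemma div (hf : HasPowerGrowth f p L) (hg : HasPowerGrowth g q K) (hK : K ≠ 0) :
    HasPowerGrowth (fun n => f n / g n) (p - q) (L / K) := by
  refine (Tendsto.div hf hg hK).congr' ?_
  filter_upwards [eventually_natCast_pos] with n hn
  rw [Real.rpow_sub hn, Pi.div_apply, div_div_div_comm]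

lemma pow (hf : HasPowerGrowth f q L) (k : ℕ) :
    HasPowerGrowth (fun n => f n ^ k) (q * k) (L ^ k) := by
  refine (Tendsto.pow hf k).congr fun n => ?_
  rw [div_pow, Real.rpow_mul n.cast_nonneg, Real.rpow_natCast]

lemma tendsto_div (hf : HasPowerGrowth f q L) (hg : HasPowerGrowth g q K) (hK : K ≠ 0) :
    Tendsto (fun n => f n / g n) atTop (𝓝 (L / K)) := by
  simpa [HasPowerGrowth] using hf.div hg hK

lemma of_exponent_lt (hf : HasPowerGrowth f p L) (hpq : p < q) : HasPowerGrowth f q 0 := by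
  have hpow : Tendsto (fun n : ℕ => (n : ℝ) ^ (-(q - p))) atTop (𝓝 0) :=
    (tendsto_rpow_neg_atTop (sub_pos.2 hpq)).comp tendsto_natCast_atTop_atTop
  rw [← mul_zero L]
  refine (Tendsto.mul hf hpow).congr' ?_
  filter_upwards [eventually_natCast_pos] with n hn
  rw [neg_sub, Real.rpow_sub hn, div_mul_div_cancel₀ (Real.rpow_pos_of_pos hn p).ne']

lemma add_const (hf : HasPowerGrowth f q L) (hq : 0 < q) (c : ℝ) :
    HasPowerGrowth (fun n => f n + c) q L := by
  simpa using hf.add ((hasPowerGrowth_const c).of_exponent_lt hq)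

lemma eventually_pos (hf : HasPowerGrowth f q L) (hL : 0 < L) : ∀ᶠ n in atTop, 0 < f n := by
  filter_upwards [Tendsto.eventually_const_lt hL hf, eventually_natCast_pos] with n hfn hn
  exact (div_pos_iff_of_pos_right (Real.rpow_pos_of_pos hn q)).1 hfn

lemma rpow (hf : HasPowerGrowth f q L) (hL : 0 < L) (a : ℝ) :
    HasPowerGrowth (fun n => f n ^ a) (q * a) (L ^ a) := by
  refine (Tendsto.rpow_const hf (Or.inl hL.ne')).congr' ?_
  filter_upwards [hf.eventually_pos hL] with n hfn
  rw [Real.div_rpow hfn.le (by positivity), ← Real.rpow_mul n.cast_nonneg]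

lemma natFloor (hf : HasPowerGrowth f q L) (hq : 0 < q) (hf0 : ∀ n, 0 ≤ f n) :
    HasPowerGrowth (fun n => (⌊f n⌋₊ : ℝ)) q L := by
  refine tendsto_of_tendsto_of_tendsto_of_le_of_le (hf.add_const hq (-1)) hf
    (fun n => ?_) (fun n => ?_)
  · dsimp only
    gcongr
    linarith [Nat.lt_floor_add_one (f n)]
  · dsimp only
    gcongr
    exact Nat.floor_le (hf0 n)

lemma comp {u : ℕ → ℕ} {c : ℝ} (hf : HasPowerGrowth f q L)
    (hu : HasPowerGrowth (fun n => (u n : ℝ)) 1 c) (hc : 0 < c) :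
    HasPowerGrowth (fun n => f (u n)) q (L * c ^ q) := by
  have hu' : Tendsto (fun n => (u n : ℝ) / n) atTop (𝓝 c) := by
    simpa [HasPowerGrowth] using hu
  have hu_top : Tendsto u atTop atTop := by
    rw [← tendsto_natCast_atTop_iff (R := ℝ)]
    refine (hu'.pos_mul_atTop hc tendsto_natCast_atTop_atTop).congr' ?_
    filter_upwards [eventually_natCast_pos] with n hn
    exact div_mul_cancel₀ _ hn.ne'
  refine ((Tendsto.comp hf hu_top).mul (hu'.rpow_const (p := q) (Or.inl hc.ne'))).congr' ?_
  filter_upwards [hu_top.eventually eventually_natCast_pos] with n hun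
  rw [Function.comp_apply, Real.div_rpow hun.le n.cast_nonneg,
    div_mul_div_cancel₀ (Real.rpow_pos_of_pos hun q).ne']

end HasPowerGrowth

lemma hasPowerGrowth_rpow_succ_sub_rpow (q : ℝ) :
    HasPowerGrowth (fun n => ((n : ℝ) + 1) ^ (q + 1) - (n : ℝ) ^ (q + 1)) q (q + 1) := by
  have hderiv : HasDerivAt (fun x : ℝ => x ^ (q + 1)) (q + 1) 1 := by
    simpa using Real.hasDerivAt_rpow_const (x := 1) (p := q + 1) (Or.inl one_ne_zero)
  have hinv : Tendsto (fun n : ℕ => (n : ℝ)⁻¹) atTop (𝓝[>] 0) :=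
    tendsto_inv_atTop_nhdsGT_zero.comp tendsto_natCast_atTop_atTop
  refine (hderiv.tendsto_slope_zero_right.comp hinv).congr' ?_
  filter_upwards [eventually_natCast_pos] with n hn
  have hfactor : (n : ℝ) + 1 = n * (1 + (n : ℝ)⁻¹) := by field_simp
  simp only [Function.comp_apply, inv_inv, smul_eq_mul, Real.one_rpow]
  rw [hfactor, Real.mul_rpow hn.le (by positivity), Real.rpow_add_one hn.ne']
  field_simp

namespace HasPowerGrowth

variable {f : ℕ → ℝ} {q L : ℝ}

/- Stolz–Cesàro: compare `f` with the increments of `n ^ (q + 1)`, which telescope. -/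
lemma sum_range (hf : HasPowerGrowth f q L) (hq : -1 < q) :
    HasPowerGrowth (fun n => ∑ t ∈ Finset.range n, f t) (q + 1) (L / (q + 1)) := by
  have hq1 : 0 < q + 1 := by linarith
  set v : ℕ → ℝ := fun n => ((n : ℝ) + 1) ^ (q + 1) - (n : ℝ) ^ (q + 1) with hv
  have hv_growth : HasPowerGrowth v q (q + 1) := hasPowerGrowth_rpow_succ_sub_rpow q
  have hv_pos (n : ℕ) : 0 < v n :=
    sub_pos.2 (Real.rpow_lt_rpow n.cast_nonneg (lt_add_one _) hq1)
  have hv_sum (n : ℕ) : ∑ t ∈ Finset.range n, v t = (n : ℝ) ^ (q + 1) := by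
    simpa [hv, Real.zero_rpow hq1.ne'] using
      Finset.sum_range_sub (fun n : ℕ => (n : ℝ) ^ (q + 1)) n
  have hv_top : Tendsto (fun n => ∑ t ∈ Finset.range n, v t) atTop atTop := by
    simp only [hv_sum]
    exact (tendsto_rpow_atTop hq1).comp tendsto_natCast_atTop_atTop
  have hdiff : (fun n => f n - L / (q + 1) * v n) =o[atTop] v := by
    refine (Asymptotics.isLittleO_iff_tendsto fun n hn => absurd hn (hv_pos n).ne').2 ?_
    simpa [div_mul_cancel₀ _ hq1.ne'] using
      (hf.sub (hv_growth.const_mul (L / (q + 1)))).tendsto_div hv_growth hq1.ne'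
  have hsum : HasPowerGrowth
      (fun n => ∑ t ∈ Finset.range n, f t - L / (q + 1) * (n : ℝ) ^ (q + 1)) (q + 1) 0 := by
    simpa only [HasPowerGrowth, Finset.sum_sub_distrib, ← Finset.mul_sum, hv_sum] using
      (hdiff.sum_range (fun n => (hv_pos n).le) hv_top).tendsto_div_nhds_zero
  simpa using hsum.add ((hasPowerGrowth_rpow (q + 1)).const_mul (L / (q + 1)))

lemma sum_Icc (hf : HasPowerGrowth f q L) (hq : -1 < q) :
    HasPowerGrowth (fun n => ∑ x ∈ Finset.Icc 1 n, f x) (q + 1) (L / (q + 1)) := by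
  have hsucc : HasPowerGrowth (fun n => f (n + 1)) q L := by
    have hshift : HasPowerGrowth (fun n => ((n + 1 : ℕ) : ℝ)) 1 1 := by
      simpa using hasPowerGrowth_natCast.add_const one_pos 1
    simpa using hf.comp hshift one_pos
  convert hsucc.sum_range hq using 2 with n
  rw [← Finset.Ico_add_one_right_eq_Icc, Finset.sum_Ico_eq_sum_range]
  simp [add_comm]

end HasPowerGrowth

/-- The sum of the `q`-th powers of `1, …, n`. -/
def powSum (q : ℝ) (n : ℕ) : ℝ := ∑ x ∈ Finset.Icc 1 n, (x : ℝ) ^ q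

lemma natCast_pos_of_mem_Icc {n x : ℕ} (hx : x ∈ Finset.Icc 1 n) : (0 : ℝ) < x := by
  exact_mod_cast (Finset.mem_Icc.1 hx).1

lemma powSum_pos (q : ℝ) {n : ℕ} (hn : 1 ≤ n) : 0 < powSum q n := by
  refine Finset.sum_pos (fun y hy => ?_) ⟨1, by simp [hn]⟩
  have := natCast_pos_of_mem_Icc hy
  positivity

lemma hasPowerGrowth_powSum {q : ℝ} (hq : -1 < q) :
    HasPowerGrowth (powSum q) (q + 1) (1 / (q + 1)) :=
  (hasPowerGrowth_rpow q).sum_Icc hq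

/-! ### Runs and finding times -/

/-- The boxes checked in the first `n` steps of the run `w`. -/
def checked (w : ℕ → ℕ) (n : ℕ) : Finset ℕ := (Finset.range n).image w

lemma mem_checked {w : ℕ → ℕ} {n x : ℕ} : x ∈ checked w n ↔ ∃ s < n, w s = x := by
  simp [checked]

lemma card_checked_le (w : ℕ → ℕ) (n : ℕ) : (checked w n).card ≤ n :=
  Finset.card_image_le.trans_eq (Finset.card_range n)

lemma checked_update (w : ℕ → ℕ) (n y : ℕ) :
    checked (Function.update w n y) (n + 1) = insert y (checked w n) := by
  rw [checked, Finset.range_add_one, Finset.image_insert, Function.update_self, checked]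
  congr 1
  refine Finset.image_congr fun s hs => Function.update_of_ne ?_ _ _
  exact (Finset.mem_range.1 hs).ne

lemma checked_update_of_le (w : ℕ → ℕ) {t n : ℕ} (htn : t ≤ n) (y : ℕ) :
    checked (Function.update w n y) t = checked w t :=
  Finset.image_congr fun _ hs =>
    Function.update_of_ne ((Finset.mem_range.1 hs).trans_le htn).ne _ _

/-- The event that the first `t` steps of a searcher's run miss box `x`. -/
def missed (x t : ℕ) : Set (ℕ → ℕ) := {w | x ∉ checked w t}

lemma missed_eq_iInter (x t : ℕ) : missed x t = ⋂ s < t, {w | w s ≠ x} := by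
  ext w
  simp [missed, mem_checked]

lemma measurableSet_missed (x t : ℕ) : MeasurableSet (missed x t) := by
  rw [missed_eq_iInter]
  exact .iInter fun s => .iInter fun _ =>
    (measurableSet_eq_fun (measurable_pi_apply s) measurable_const).compl

lemma missed_anti (x : ℕ) : Antitone (missed x) := fun _ _ hst _ hw hx =>
  hw (Finset.image_subset_image (Finset.range_mono hst) hx)

lemma findTime_eq_tsum {k : ℕ} (x : ℕ) (w : Fin k → ℕ → ℕ) :
    findTime x w = ∑' t : ℕ, (Set.univ.pi fun _ => missed x t).indicator 1 w := by
  classical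
  have hmem (t : ℕ) : w ∈ (Set.univ.pi fun _ => missed x t) ↔ ∀ s < t, ¬∃ i, w i s = x := by
    simp only [Set.mem_univ_pi, missed_eq_iInter, Set.mem_iInter, Set.mem_ofPred_eq, not_exists]
    tauto
  simp only [Set.indicator_apply, hmem, Pi.one_apply]
  by_cases hfound : ∃ t i, w i t = x
  · have hbefore (t : ℕ) :
        (∀ s < t, ¬∃ i, w i s = x) ↔ t ∈ Finset.range (Nat.find hfound + 1) := by
      rw [Finset.mem_range, Nat.lt_succ_iff, Nat.le_find_iff]
    have hfind : findTime x w = (Nat.find hfound : ℝ≥0∞) + 1 := by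
      refine le_antisymm (iInf₂_le (Nat.find hfound) (Nat.find_spec hfound)) ?_
      refine le_iInf₂ fun t ht => ?_
      gcongr
      exact Nat.find_min' hfound ht
    simp only [hbefore]
    rw [hfind, tsum_eq_sum (s := Finset.range (Nat.find hfound + 1)) fun t ht => if_neg ht,
      Finset.sum_congr rfl fun t ht => if_pos ht]
    simp
  · push Not at hfound
    simp [findTime, hfound]

lemma measurable_findTime {k : ℕ} (x : ℕ) : Measurable (findTime (k := k) x) := by
  simp only [funext (findTime_eq_tsum (k := k) x)]
  exact .tsum fun t =>
    measurable_one.indicator (MeasurableSet.univ_pi fun _ => measurableSet_missed x t)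

lemma lintegral_findTime_nonCoordinating (k x : ℕ) (A : Measure (ℕ → ℕ)) [IsProbabilityMeasure A] :
    ∫⁻ w, findTime x w ∂(nonCoordinating k A) = ∑' t : ℕ, A (missed x t) ^ k := by
  have hmeas (t : ℕ) : MeasurableSet (Set.univ.pi fun _ : Fin k => missed x t) :=
    MeasurableSet.univ_pi fun _ => measurableSet_missed x t
  simp only [findTime_eq_tsum]
  rw [lintegral_tsum fun t => (measurable_one.indicator (hmeas t)).aemeasurable]
  refine tsum_congr fun t => ?_
  rw [lintegral_indicator_one (hmeas t), nonCoordinating, Measure.pi_pi]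
  simp

lemma lintegral_findTime_cord {k x : ℕ} (hk : 0 < k) (hx : 1 ≤ x) :
    ∫⁻ w, findTime x w ∂(cord k) = ((x - 1) / k : ℕ) + 1 := by
  rw [cord, lintegral_dirac' _ (measurable_findTime x), findTime]
  have hmod := Nat.div_add_mod' (x - 1) k
  refine le_antisymm (iInf₂_le ((x - 1) / k) ⟨⟨(x - 1) % k, Nat.mod_lt _ hk⟩, ?_⟩) (le_iInf₂ ?_)
  · rintro t ⟨i, hi⟩
    have hxi : x - 1 = i + t * k := by lia
    gcongr
    rw [hxi, Nat.add_mul_div_right _ _ hk, Nat.div_eq_of_lt i.2, zero_add]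
  · dsimp only
    lia

lemma sum_one_sub_missed_le (A : Measure (ℕ → ℕ)) [IsProbabilityMeasure A] (S : Finset ℕ)
    (t : ℕ) : ∑ x ∈ S, (1 - A.real (missed x t)) ≤ t := by
  have hint (x : ℕ) : Integrable ((missed x t)ᶜ.indicator (1 : (ℕ → ℕ) → ℝ)) A :=
    (integrable_const 1).indicator (measurableSet_missed x t).compl
  have hcount (w : ℕ → ℕ) : ∑ x ∈ S, (missed x t)ᶜ.indicator (1 : (ℕ → ℕ) → ℝ) w ≤ t := by
    calc ∑ x ∈ S, (missed x t)ᶜ.indicator (1 : (ℕ → ℕ) → ℝ) w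
        = ((S ∩ checked w t).card : ℝ) := by
          simp [Set.indicator_apply, missed]
      _ ≤ t := by
          exact_mod_cast (Finset.card_le_card Finset.inter_subset_right).trans
            (card_checked_le w t)
  calc ∑ x ∈ S, (1 - A.real (missed x t))
      = ∫ w, ∑ x ∈ S, (missed x t)ᶜ.indicator (1 : (ℕ → ℕ) → ℝ) w ∂A := by
        rw [integral_finsetSum _ fun x _ => hint x]
        refine Finset.sum_congr rfl fun x _ => ?_
        rw [integral_indicator_one (measurableSet_missed x t).compl,
          probReal_compl_eq_one_sub (measurableSet_missed x t)]
    _ ≤ ∫ _, (t : ℝ) ∂A := by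
        refine integral_mono (integrable_finsetSum _ fun x _ => hint x) (integrable_const _) hcount
    _ = t := by simp

/-! ### Expected times for power weights -/

/-- The Pareto distribution without its normalization: weight `x ^ (-b)` on the boxes `1, …, M`.
Ratios of expected times do not see the normalization. -/
def powerWeight (M : ℕ) (b : ℝ) (x : ℕ) : ℝ≥0∞ :=
  if x ∈ Finset.Icc 1 M then ENNReal.ofReal ((x : ℝ) ^ (-b)) else 0

lemma paretoDist_eq_powerWeight (M : ℕ) (b : ℝ) (x : ℕ) :
    paretoDist M b x = ENNReal.ofReal (powSum (-b) M)⁻¹ * powerWeight M b x := by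
  by_cases hx : x ∈ Finset.Icc 1 M
  · rw [paretoDist, powerWeight, if_pos hx, if_pos hx, ← ENNReal.ofReal_mul' (by positivity)]
    simp [powSum, Real.rpow_neg, div_eq_inv_mul]
  · simp [paretoDist, powerWeight, hx]

lemma expectedTime_const_mul {k : ℕ} (c : ℝ≥0∞) (p : ℕ → ℝ≥0∞) (P : Measure (Fin k → ℕ → ℕ)) :
    expectedTime (fun x => c * p x) P = c * expectedTime p P := by
  simp only [expectedTime, mul_assoc, ENNReal.tsum_mul_left]

lemma expectedTime_paretoDist_div {k l M : ℕ} (hM : 1 ≤ M) (b : ℝ)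
    (P : Measure (Fin k → ℕ → ℕ)) (P' : Measure (Fin l → ℕ → ℕ)) :
    expectedTime (paretoDist M b) P / expectedTime (paretoDist M b) P' =
      expectedTime (powerWeight M b) P / expectedTime (powerWeight M b) P' := by
  simp only [funext (paretoDist_eq_powerWeight M b), expectedTime_const_mul]
  exact ENNReal.mul_div_mul_left _ _ (by simpa using powSum_pos (-b) hM) ENNReal.ofReal_ne_top

lemma expectedTime_powerWeight {k : ℕ} (M : ℕ) (b : ℝ) (P : Measure (Fin k → ℕ → ℕ)) :
    expectedTime (powerWeight M b) P =
      ∑ x ∈ Finset.Icc 1 M, ENNReal.ofReal ((x : ℝ) ^ (-b)) * ∫⁻ w, findTime x w ∂P := by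
  rw [expectedTime, tsum_eq_sum (s := Finset.Icc 1 M) fun x hx => by simp [powerWeight, hx]]
  exact Finset.sum_congr rfl fun x hx => by rw [powerWeight, if_pos hx]

lemma expectedTime_powerWeight_cord {k : ℕ} (hk : 0 < k) (M : ℕ) (b : ℝ) :
    expectedTime (powerWeight M b) (cord k) = ENNReal.ofReal
      (∑ x ∈ Finset.Icc 1 M, (x : ℝ) ^ (-b) * ((((x - 1) / k : ℕ) : ℝ) + 1)) := by
  rw [expectedTime_powerWeight, ENNReal.ofReal_sum_of_nonneg fun x _ => by positivity]
  refine Finset.sum_congr rfl fun x hx => ?_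
  rw [lintegral_findTime_cord hk (Finset.mem_Icc.1 hx).1, ENNReal.ofReal_mul (by positivity),
    ENNReal.ofReal_add (by positivity) zero_le_one]
  simp

/-- The expected weight of the boxes that none of `k` independent searchers with law `A` has
checked in the first `t` steps. -/
def missedWeight (k : ℕ) (b : ℝ) (A : Measure (ℕ → ℕ)) (M t : ℕ) : ℝ :=
  ∑ x ∈ Finset.Icc 1 M, (x : ℝ) ^ (-b) * A.real (missed x t) ^ k

lemma missedWeight_nonneg (k : ℕ) (b : ℝ) (A : Measure (ℕ → ℕ)) (M t : ℕ) :
    0 ≤ missedWeight k b A M t :=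
  Finset.sum_nonneg fun x _ => by positivity

lemma expectedTime_powerWeight_nonCoordinating (k M : ℕ) (b : ℝ) (A : Measure (ℕ → ℕ))
    [IsProbabilityMeasure A] :
    expectedTime (powerWeight M b) (nonCoordinating k A) =
      ∑' t : ℕ, ENNReal.ofReal (missedWeight k b A M t) := by
  simp only [expectedTime_powerWeight, lintegral_findTime_nonCoordinating, ← ENNReal.tsum_mul_left]
  rw [← Summable.tsum_finsetSum fun _ _ => ENNReal.summable]
  refine tsum_congr fun t => ?_
  rw [missedWeight, ENNReal.ofReal_sum_of_nonneg fun x _ => by positivity]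
  refine Finset.sum_congr rfl fun x _ => ?_
  rw [ENNReal.ofReal_mul (by positivity), ENNReal.ofReal_pow measureReal_nonneg,
    ofReal_measureReal]

section

variable {k M : ℕ} {b : ℝ} {A : Measure (ℕ → ℕ)} [IsProbabilityMeasure A] {f : ℕ → ℝ}

lemma ofReal_sum_le_expectedTime (hf : ∀ t < M, f t ≤ missedWeight k b A M t) :
    ENNReal.ofReal (∑ t ∈ Finset.range M, f t) ≤
      expectedTime (powerWeight M b) (nonCoordinating k A) := by
  calc ENNReal.ofReal (∑ t ∈ Finset.range M, f t)
      ≤ ENNReal.ofReal (∑ t ∈ Finset.range M, missedWeight k b A M t) :=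
        ENNReal.ofReal_le_ofReal <|
          Finset.sum_le_sum fun t ht => hf t (Finset.mem_range.1 ht)
    _ = ∑ t ∈ Finset.range M, ENNReal.ofReal (missedWeight k b A M t) :=
        ENNReal.ofReal_sum_of_nonneg fun t _ => missedWeight_nonneg k b A M t
    _ ≤ ∑' t : ℕ, ENNReal.ofReal (missedWeight k b A M t) := ENNReal.sum_le_tsum _
    _ = expectedTime (powerWeight M b) (nonCoordinating k A) :=
        (expectedTime_powerWeight_nonCoordinating k M b A).symm

lemma expectedTime_le_ofReal_sum (hf : ∀ t < M, missedWeight k b A M t ≤ f t)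
    (hzero : ∀ t, M ≤ t → missedWeight k b A M t = 0) :
    expectedTime (powerWeight M b) (nonCoordinating k A) ≤
      ENNReal.ofReal (∑ t ∈ Finset.range M, f t) := by
  calc expectedTime (powerWeight M b) (nonCoordinating k A)
      = ∑' t : ℕ, ENNReal.ofReal (missedWeight k b A M t) :=
        expectedTime_powerWeight_nonCoordinating k M b A
    _ = ∑ t ∈ Finset.range M, ENNReal.ofReal (missedWeight k b A M t) :=
        tsum_eq_sum fun t ht => by rw [hzero t (by simpa using ht), ENNReal.ofReal_zero]
    _ = ENNReal.ofReal (∑ t ∈ Finset.range M, missedWeight k b A M t) :=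
        (ENNReal.ofReal_sum_of_nonneg fun t _ => missedWeight_nonneg k b A M t).symm
    _ ≤ ENNReal.ofReal (∑ t ∈ Finset.range M, f t) :=
        ENNReal.ofReal_le_ofReal <|
          Finset.sum_le_sum fun t ht => hf t (Finset.mem_range.1 ht)

end

/-! ### The lower bound -/

lemma pow_add_mul_sub_le_pow {F G : ℝ} (hF : 0 ≤ F) (hG : 0 < G) (k : ℕ) :
    G ^ k + k * G ^ (k - 1) * (F - G) ≤ F ^ k := by
  rcases k with _ | k
  · simp
  have hbernoulli := one_add_mul_le_pow (a := F / G - 1) (by linarith [div_nonneg hF hG.le]) (k + 1)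
  rw [add_sub_cancel, div_pow, le_div_iff₀ (by positivity)] at hbernoulli
  refine le_trans (le_of_eq ?_) hbernoulli
  rw [Nat.add_sub_cancel]
  field_simp
  ring

/- Weak duality: `μ` is a Lagrange multiplier for the budget constraint, and the hypothesis `hopt`
is the first-order condition for the profile `g` to minimize `∑ x ∈ S, p x * F x ^ k`. -/
lemma sum_mul_pow_add_le_sum_mul_pow {ι : Type*} {S : Finset ι} {p F g : ι → ℝ} {μ t : ℝ} (k : ℕ)
    (hp : ∀ x ∈ S, 0 ≤ p x) (hF : ∀ x ∈ S, F x ∈ Set.Icc 0 1) (hg : ∀ x ∈ S, 0 < g x)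
    (hopt : ∀ x ∈ S, k * p x * g x ^ (k - 1) = μ ∨ g x = 1 ∧ k * p x ≤ μ) (hμ : 0 ≤ μ)
    (hbudget : ∑ x ∈ S, (1 - F x) ≤ t) :
    ∑ x ∈ S, p x * g x ^ k + μ * (∑ x ∈ S, (1 - g x) - t) ≤ ∑ x ∈ S, p x * F x ^ k := by
  have hterm : ∀ x ∈ S, p x * g x ^ k + μ * ((1 - g x) - (1 - F x)) ≤ p x * F x ^ k := by
    intro x hx
    have htangent := mul_le_mul_of_nonneg_left
      (pow_add_mul_sub_le_pow (hF x hx).1 (hg x hx) k) (hp x hx)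
    rcases hopt x hx with hμx | ⟨hgx, hμx⟩
    · rw [← hμx]
      linarith
    · have := mul_le_mul_of_nonneg_right hμx (sub_nonneg.2 (hF x hx).2)
      rw [hgx] at htangent ⊢
      simp only [one_pow, mul_one] at htangent ⊢
      linarith
  have hsum := Finset.sum_le_sum hterm
  rw [Finset.sum_add_distrib, ← Finset.mul_sum, Finset.sum_sub_distrib] at hsum
  linarith [mul_le_mul_of_nonneg_left hbudget hμ]

lemma missedWeight_ge_of_multiplier {k M t : ℕ} {b μ : ℝ} {g : ℕ → ℝ} (A : Measure (ℕ → ℕ))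
    [IsProbabilityMeasure A] (hg : ∀ x ∈ Finset.Icc 1 M, 0 < g x)
    (hopt : ∀ x ∈ Finset.Icc 1 M,
      k * (x : ℝ) ^ (-b) * g x ^ (k - 1) = μ ∨ g x = 1 ∧ k * (x : ℝ) ^ (-b) ≤ μ) (hμ : 0 ≤ μ) :
    ∑ x ∈ Finset.Icc 1 M, (x : ℝ) ^ (-b) * g x ^ k +
      μ * (∑ x ∈ Finset.Icc 1 M, (1 - g x) - t) ≤ missedWeight k b A M t :=
  sum_mul_pow_add_le_sum_mul_pow k (fun x _ => by positivity)
    (fun _ _ => ⟨measureReal_nonneg, measureReal_le_one⟩) hg hopt hμ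
    (sum_one_sub_missed_le A _ t)

/-- The last box that a searcher following the Pareto algorithm may check in step `n`, if there is
no bound on the boxes. -/
def horizon (σ : ℝ) (n : ℕ) : ℕ := ⌊(n : ℝ) / σ⌋₊

lemma le_horizon_iff {σ : ℝ} (hσ : 0 < σ) {n x : ℕ} : x ≤ horizon σ n ↔ σ * x ≤ n := by
  rw [horizon, Nat.le_floor_iff (by positivity), le_div_iff₀ hσ, mul_comm]

lemma horizon_le {σ : ℝ} (hσ : 0 < σ) {M n : ℕ} (hn : n ≤ ⌊σ * M⌋₊) : horizon σ n ≤ M := by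
  refine Nat.floor_le_of_le ?_
  rw [div_le_iff₀ hσ, mul_comm]
  exact (Nat.cast_le.2 hn).trans (Nat.floor_le (by positivity))

/-- The expected weight of the boxes in `1, …, N` that are missed by `k` independent searchers, when
each of them misses box `x` with probability `((σ * x + δ) / m) ^ a`. -/
def profileSum (k : ℕ) (a b σ δ m : ℝ) (N : ℕ) : ℝ :=
  ∑ x ∈ Finset.Icc 1 N, (x : ℝ) ^ (-b) * (((σ * x + δ) / m) ^ a) ^ k

/-- The change of the missed weight after `t` steps, compared with missing everything, when box
`x ≤ horizon σ (t + 1)` is missed with probability `((σ * x + δ) / (t + 1)) ^ a`. -/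
def headExcess (k : ℕ) (a b σ δ : ℝ) (t : ℕ) : ℝ :=
  profileSum k a b σ δ (t + 1) (horizon σ (t + 1)) - powSum (-b) (horizon σ (t + 1))

/-- The expected number of boxes checked in `t` steps, minus `t`, when box `x ≤ horizon σ (t + 1)`
is missed with probability `(σ * x / (t + 1)) ^ a`. -/
def budgetGap (a σ : ℝ) (t : ℕ) : ℝ :=
  ∑ x ∈ Finset.Icc 1 (horizon σ (t + 1)), (1 - (σ * x / (t + 1)) ^ a) - t

/-- The probabilities of missing box `x` in `t` steps that are optimal, up to lower order terms,
while only the boxes up to `horizon σ (t + 1)` are worth checking. -/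
def headProfile (a σ : ℝ) (t x : ℕ) : ℝ := min 1 (σ * x / (t + 1)) ^ a

lemma headProfile_of_le {a σ : ℝ} (hσ : 0 < σ) {t x : ℕ} (hx : x ≤ horizon σ (t + 1)) :
    headProfile a σ t x = (σ * x / (t + 1)) ^ a := by
  rw [headProfile, min_eq_right]
  rw [div_le_one (by positivity)]
  exact_mod_cast (le_horizon_iff hσ).1 hx

lemma headProfile_of_lt {a σ : ℝ} (hσ : 0 < σ) {t x : ℕ} (hx : horizon σ (t + 1) < x) :
    headProfile a σ t x = 1 := by
  rw [headProfile, min_eq_left, Real.one_rpow]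
  rw [one_le_div (by positivity)]
  have := mt (le_horizon_iff hσ).2 hx.not_ge
  push_cast at this
  linarith

lemma sum_Icc_eq_sum_Icc_of_le {f h : ℕ → ℝ} {M N : ℕ} (hNM : N ≤ M)
    (hfh : ∀ x ≤ N, f x = h x) (hf : ∀ x, N < x → f x = 0) :
    ∑ x ∈ Finset.Icc 1 M, f x = ∑ x ∈ Finset.Icc 1 N, h x := by
  rw [← Finset.sum_subset (Finset.Icc_subset_Icc_right hNM) fun x hxM hxN => hf x ?_]
  · exact Finset.sum_congr rfl fun x hx => hfh x (Finset.mem_Icc.1 hx).2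
  · simp only [Finset.mem_Icc] at hxM hxN
    lia

section

variable {k : ℕ} {a b σ : ℝ} {M t : ℕ}

lemma sum_mul_headProfile_pow (k : ℕ) (a b : ℝ) (hσ : 0 < σ) (hNM : horizon σ (t + 1) ≤ M) :
    ∑ x ∈ Finset.Icc 1 M, (x : ℝ) ^ (-b) * headProfile a σ t x ^ k =
      powSum (-b) M + headExcess k a b σ 0 t := by
  rw [← sub_eq_iff_eq_add', headExcess, profileSum, powSum, powSum, ← Finset.sum_sub_distrib,
    ← Finset.sum_sub_distrib]
  refine sum_Icc_eq_sum_Icc_of_le hNM (fun x hx => ?_) (fun x hx => ?_)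
  · rw [headProfile_of_le hσ hx, add_zero]
  · simp [headProfile_of_lt hσ hx]

lemma sum_one_sub_headProfile (a : ℝ) (hσ : 0 < σ) (hNM : horizon σ (t + 1) ≤ M) :
    ∑ x ∈ Finset.Icc 1 M, (1 - headProfile a σ t x) - t = budgetGap a σ t := by
  rw [budgetGap, sum_Icc_eq_sum_Icc_of_le hNM]
  · intro x hx
    rw [headProfile_of_le hσ hx]
  · intro x hx
    simp [headProfile_of_lt hσ hx]

lemma rpow_pow_sub_one (hk : 1 ≤ k) (hab : a * (k - 1) = b) {x : ℝ} (hx : 0 ≤ x) :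
    (x ^ a) ^ (k - 1) = x ^ b := by
  rw [← Real.rpow_mul_natCast hx, Nat.cast_pred hk, hab]

lemma rpow_neg_mul_rpow_pow (hab : a * (k - 1) = b) {x : ℝ} (hx : 0 < x) :
    x ^ (-b) * (x ^ a) ^ k = x ^ a := by
  rw [← Real.rpow_mul_natCast hx.le, ← Real.rpow_add hx]
  congr 1
  linarith

lemma powSum_add_headExcess_le_missedWeight (hk : 1 ≤ k) (hab : a * (k - 1) = b) (hb : 0 ≤ b)
    (hσ : 0 < σ) (A : Measure (ℕ → ℕ)) [IsProbabilityMeasure A] (ht : t < ⌊σ * M⌋₊) :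
    powSum (-b) M + (headExcess k a b σ 0 t + k * (σ / (t + 1)) ^ b * budgetGap a σ t) ≤
      missedWeight k b A M t := by
  have hNM : horizon σ (t + 1) ≤ M := horizon_le hσ ht
  rw [← add_assoc, ← sum_mul_headProfile_pow k a b hσ hNM, ← sum_one_sub_headProfile a hσ hNM]
  have hweight {x : ℕ} (hx : x ∈ Finset.Icc 1 M) :
      (x : ℝ) ^ (-b) * (σ * x / (t + 1)) ^ b = (σ / (t + 1)) ^ b := by
    have := natCast_pos_of_mem_Icc hx
    rw [Real.rpow_neg this.le, mul_div_right_comm, Real.mul_rpow (by positivity) this.le]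
    field_simp
  refine missedWeight_ge_of_multiplier A (fun x hx => ?_) (fun x hx => ?_) (by positivity)
  · have := natCast_pos_of_mem_Icc hx
    exact Real.rpow_pos_of_pos (lt_min one_pos (by positivity)) a
  rcases le_or_gt x (horizon σ (t + 1)) with hxN | hxN
  · left
    rw [headProfile_of_le hσ hxN, rpow_pow_sub_one hk hab (by positivity), mul_assoc, hweight hx]
  · right
    refine ⟨headProfile_of_lt hσ hxN, ?_⟩
    rw [← hweight hx]
    have hfar : 1 ≤ σ * x / (t + 1) := by
      rw [one_le_div (by positivity)]
      exact_mod_cast (not_le.1 (mt (le_horizon_iff hσ).2 hxN.not_ge)).le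
    exact mul_le_mul_of_nonneg_left
      (le_mul_of_one_le_right (by positivity) (Real.one_le_rpow hfar hb)) k.cast_nonneg

lemma mul_sub_pow_le_missedWeight (hk : 1 ≤ k) (hab : a * (k - 1) = b)
    (A : Measure (ℕ → ℕ)) [IsProbabilityMeasure A] (ht : t < M) :
    (powSum a M ^ (k - 1))⁻¹ * ((M : ℝ) - t) ^ k ≤ missedWeight k b A M t := by
  have hsum : 0 < powSum a M := powSum_pos a (by lia)
  have htM : 0 < (M : ℝ) - t := sub_pos.2 (by exact_mod_cast ht)
  set c : ℝ := (M - t) / powSum a M with hc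
  have hc0 : 0 < c := by positivity
  have hvalue : ∑ x ∈ Finset.Icc 1 M, (x : ℝ) ^ (-b) * (c * (x : ℝ) ^ a) ^ k =
      (powSum a M ^ (k - 1))⁻¹ * ((M : ℝ) - t) ^ k := by
    calc ∑ x ∈ Finset.Icc 1 M, (x : ℝ) ^ (-b) * (c * (x : ℝ) ^ a) ^ k
        = c ^ k * powSum a M := by
          rw [powSum, Finset.mul_sum]
          refine Finset.sum_congr rfl fun x hx => ?_
          rw [mul_pow, mul_left_comm, rpow_neg_mul_rpow_pow hab (natCast_pos_of_mem_Icc hx)]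
      _ = (powSum a M ^ (k - 1))⁻¹ * ((M : ℝ) - t) ^ k := by
          rw [hc, div_pow, ← pow_sub_one_mul (by lia : k ≠ 0) (powSum a M)]
          field_simp
  have hbudget : ∑ x ∈ Finset.Icc 1 M, (1 - c * (x : ℝ) ^ a) - t = 0 := by
    rw [Finset.sum_sub_distrib, ← Finset.mul_sum, ← powSum, hc, div_mul_cancel₀ _ hsum.ne']
    simp
  have hduality := missedWeight_ge_of_multiplier (t := t) (b := b) (k := k) (M := M)
    (g := fun x => c * (x : ℝ) ^ a) (μ := k * c ^ (k - 1)) A (fun x hx => ?_)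
    (fun x hx => Or.inl ?_) (by positivity)
  · rwa [hvalue, hbudget, mul_zero, add_zero] at hduality
  · have := natCast_pos_of_mem_Icc hx
    positivity
  · have := natCast_pos_of_mem_Icc hx
    rw [mul_pow, rpow_pow_sub_one hk hab this.le, Real.rpow_neg this.le]
    field_simp

end

/-! ### The Pareto algorithm -/

/-- The boxes `1, …, window σ M n` are those that the Pareto algorithm allows in step `n`. -/
def window (σ : ℝ) (M n : ℕ) : ℕ := min M (horizon σ n)

lemma window_le_succ {σ : ℝ} (hσ : 0 ≤ σ) (M n : ℕ) : window σ M n ≤ window σ M (n + 1) := by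
  unfold window horizon
  gcongr
  exact n.le_succ

lemma lt_window_succ {σ : ℝ} (hσ0 : 0 < σ) (hσ1 : σ ≤ 1) {M n : ℕ} (hn : n < M) :
    n < window σ M (n + 1) := by
  refine lt_min hn ((le_horizon_iff hσ0).2 ?_)
  exact mul_le_of_le_one_left (by positivity) hσ1

/-- The run `w` checks `n` different boxes in its first `n` steps, all of them allowed in
step `n`. -/
def IsFresh (σ : ℝ) (M n : ℕ) (w : ℕ → ℕ) : Prop :=
  checked w n ⊆ Finset.Icc 1 (window σ M n) ∧ (checked w n).card = n

lemma unchecked_succ (σ : ℝ) (M : ℕ) (w : ℕ → ℕ) (n : ℕ) :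
    unchecked σ M w (n + 1) = Finset.Icc 1 (window σ M (n + 1)) \ checked w n := rfl

namespace IsFresh

variable {σ : ℝ} {M n : ℕ} {w : ℕ → ℕ}

lemma card_unchecked (hw : IsFresh σ M n w) (hσ : 0 ≤ σ) :
    (unchecked σ M w (n + 1)).card = window σ M (n + 1) - n := by
  have hsub : checked w n ⊆ Finset.Icc 1 (window σ M (n + 1)) :=
    hw.1.trans (Finset.Icc_subset_Icc_right (window_le_succ hσ M n))
  rw [unchecked_succ, Finset.card_sdiff_of_subset hsub, hw.2, Nat.card_Icc, Nat.add_sub_cancel]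

lemma update (hw : IsFresh σ M n w) (hσ : 0 ≤ σ) {y : ℕ} (hy : y ∈ unchecked σ M w (n + 1)) :
    IsFresh σ M (n + 1) (Function.update w n y) := by
  rw [unchecked_succ, Finset.mem_sdiff] at hy
  rw [IsFresh, checked_update, Finset.card_insert_of_notMem hy.2, hw.2]
  exact ⟨Finset.insert_subset hy.1
    (hw.1.trans (Finset.Icc_subset_Icc_right (window_le_succ hσ M n))), rfl⟩

end IsFresh

lemma uniformChoice_of_nonempty {s : Finset ℕ} (hs : s.Nonempty) :
    uniformChoice s = PMF.uniformOfFinset s hs := dif_pos hs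

lemma isFresh_of_mem_support {σ : ℝ} (hσ0 : 0 < σ) (hσ1 : σ ≤ 1) {M n : ℕ} (hn : n ≤ M)
    {w : ℕ → ℕ} (hw : w ∈ (paretoRun σ M n).support) : IsFresh σ M n w := by
  induction n generalizing w with
  | zero => simp [IsFresh, checked]
  | succ n ih =>
    simp only [paretoRun, PMF.mem_support_bind_iff, PMF.mem_support_map_iff] at hw
    obtain ⟨v, hv, y, hy, rfl⟩ := hw
    have hfresh : IsFresh σ M n v := ih (by lia) hv
    have hne : (unchecked σ M v (n + 1)).Nonempty := by
      rw [← Finset.card_pos, hfresh.card_unchecked hσ0.le]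
      exact Nat.sub_pos_of_lt (lt_window_succ hσ0 hσ1 hn)
    rw [uniformChoice_of_nonempty hne, PMF.mem_support_uniformOfFinset_iff] at hy
    exact hfresh.update hσ0.le hy

lemma toMeasure_bind_eq_mul {α β : Type*} [MeasurableSpace α] [MeasurableSpace β] {p : PMF α}
    {f : α → PMF β} {s : Set α} {t : Set β} {c : ℝ≥0∞} (hs : MeasurableSet s)
    (ht : MeasurableSet t)
    (hf : ∀ w ∈ p.support, (f w).toMeasure t = s.indicator (fun _ => c) w) :
    (p.bind f).toMeasure t = c * p.toMeasure s := by
  rw [PMF.toMeasure_bind_apply _ _ _ ht, PMF.toMeasure_apply _ hs, ← ENNReal.tsum_mul_left]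
  refine tsum_congr fun w => ?_
  by_cases hw : w ∈ p.support
  · by_cases hws : w ∈ s <;> simp [hf w hw, hws, mul_comm]
  · simp [(PMF.apply_eq_zero_iff p w).2 hw]

lemma toMeasure_paretoRun_succ {σ : ℝ} {M n : ℕ} {s t : Set (ℕ → ℕ)} {c : ℝ≥0∞}
    (hs : MeasurableSet s) (ht : MeasurableSet t)
    (hchoice : ∀ w ∈ (paretoRun σ M n).support,
      (uniformChoice (unchecked σ M w (n + 1))).toMeasure {y | Function.update w n y ∈ t} =
        s.indicator (fun _ => c) w) :
    (paretoRun σ M (n + 1)).toMeasure t = c * (paretoRun σ M n).toMeasure s := by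
  refine toMeasure_bind_eq_mul hs ht fun w hw => ?_
  rw [PMF.toMeasure_map_apply _ _ _ measurable_from_top ht]
  exact hchoice w hw

lemma toMeasure_paretoRun_missed (σ : ℝ) (M x : ℕ) {t n : ℕ} (htn : t ≤ n) :
    (paretoRun σ M n).toMeasure (missed x t) = (paretoRun σ M t).toMeasure (missed x t) := by
  induction n, htn using Nat.le_induction with
  | base => rfl
  | succ n htn ih =>
    rw [← ih, ← one_mul ((paretoRun σ M n).toMeasure _)]
    refine toMeasure_paretoRun_succ (measurableSet_missed x t) (measurableSet_missed x t)
      fun w _ => ?_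
    by_cases hw : w ∈ missed x t <;>
      simp_all [missed, checked_update_of_le]

instance isProbabilityMeasure_paretoAlg (σ : ℝ) (M : ℕ) : IsProbabilityMeasure (paretoAlg σ M) :=
  PMF.toMeasure.isProbabilityMeasure _

lemma toMeasure_uniformChoice_compl_singleton {s : Finset ℕ} {x : ℕ} (hx : x ∈ s) :
    (uniformChoice s).toMeasure {x}ᶜ = 1 - (s.card : ℝ≥0∞)⁻¹ := by
  have hs : s.Nonempty := ⟨x, hx⟩
  rw [uniformChoice_of_nonempty hs, prob_compl_eq_one_sub (MeasurableSet.singleton x),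
    PMF.toMeasure_apply_singleton _ _ (MeasurableSet.singleton x),
    PMF.uniformOfFinset_apply_of_mem hs hx]

section

variable {σ : ℝ} {M n x : ℕ}

lemma toMeasure_paretoRun_missed_succ (hσ0 : 0 < σ) (hσ1 : σ ≤ 1) (hn : n < M)
    (hx : x ∈ Finset.Icc 1 (window σ M (n + 1))) :
    (paretoRun σ M (n + 1)).toMeasure (missed x (n + 1)) =
      (1 - ((window σ M (n + 1) - n : ℕ) : ℝ≥0∞)⁻¹) *
        (paretoRun σ M n).toMeasure (missed x n) := by
  refine toMeasure_paretoRun_succ (measurableSet_missed x n) (measurableSet_missed x (n + 1))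
    fun w hw => ?_
  have hupdate (y : ℕ) :
      Function.update w n y ∈ missed x (n + 1) ↔ y ≠ x ∧ w ∈ missed x n := by
    simp [missed, checked_update, eq_comm]
  simp only [hupdate]
  by_cases hwx : w ∈ missed x n
  · have hxw : x ∈ unchecked σ M w (n + 1) := Finset.mem_sdiff.2 ⟨hx, hwx⟩
    have hfresh := isFresh_of_mem_support hσ0 hσ1 hn.le hw
    simpa [hwx, hfresh.card_unchecked hσ0.le] using! toMeasure_uniformChoice_compl_singleton hxw
  · simp [hwx]

lemma paretoAlg_real_missed_succ (hσ0 : 0 < σ) (hσ1 : σ ≤ 1) (hn : n < M)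
    (hx : x ∈ Finset.Icc 1 (window σ M (n + 1))) :
    (paretoAlg σ M).real (missed x (n + 1)) =
      (1 - 1 / ((window σ M (n + 1) : ℝ) - n)) * (paretoAlg σ M).real (missed x n) := by
  have hlt : n < window σ M (n + 1) := lt_window_succ hσ0 hσ1 hn
  have hone : ((window σ M (n + 1) - n : ℕ) : ℝ≥0∞)⁻¹ ≤ 1 := by
    rw [ENNReal.inv_le_one]
    exact_mod_cast Nat.sub_pos_of_lt hlt
  rw [measureReal_def, measureReal_def, paretoAlg, toMeasure_paretoRun_missed σ M x hn,
    toMeasure_paretoRun_missed σ M x hn.le, toMeasure_paretoRun_missed_succ hσ0 hσ1 hn hx,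
    ENNReal.toReal_mul, ENNReal.toReal_sub_of_le hone ENNReal.one_ne_top, ENNReal.toReal_one,
    ENNReal.toReal_inv, ENNReal.toReal_natCast, Nat.cast_sub hlt.le, one_div]

lemma mem_Icc_window_succ (hσ0 : 0 < σ) (hx : x ∈ Finset.Icc 1 M) (hxn : σ * x ≤ n + 1) :
    x ∈ Finset.Icc 1 (window σ M (n + 1)) := by
  obtain ⟨hx1, hxM⟩ := Finset.mem_Icc.1 hx
  refine Finset.mem_Icc.2 ⟨hx1, le_min hxM ((le_horizon_iff hσ0).2 ?_)⟩
  exact_mod_cast hxn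

/- Once the window has reached all of `1, …, M`, a searcher runs through its unchecked boxes in
uniformly random order, so a box still missed at step `s` is missed at step `t` with probability
`(M - t) / (M - s)`. -/
lemma paretoAlg_real_missed_mul (hσ0 : 0 < σ) (hσ1 : σ ≤ 1) {s t : ℕ} (hs : σ * M ≤ s + 1)
    (hst : s ≤ t) (htM : t ≤ M) (hx : x ∈ Finset.Icc 1 M) :
    (paretoAlg σ M).real (missed x t) * (M - s) =
      (paretoAlg σ M).real (missed x s) * (M - t) := by
  induction t, hst using Nat.le_induction with
  | base => rfl
  | succ t hst ih =>
    have hMt : σ * M ≤ ((t + 1 : ℕ) : ℝ) := by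
      have : (s : ℝ) ≤ t := by exact_mod_cast hst
      push_cast
      linarith
    have hwindow : window σ M (t + 1) = M := min_eq_left ((le_horizon_iff hσ0).2 hMt)
    have htM' : (M : ℝ) - t ≠ 0 := (sub_pos.2 (by exact_mod_cast htM)).ne'
    rw [paretoAlg_real_missed_succ hσ0 hσ1 htM (hwindow.symm ▸ hx), hwindow, mul_assoc,
      ih (by lia)]
    push_cast
    field_simp
    ring

end

section

variable {a σ : ℝ}

lemma pos_of_eq_div_one_add (ha : 0 < a) (hσ : σ = a / (1 + a)) : 0 < σ := by
  rw [hσ]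
  positivity

lemma lt_one_of_eq_div_one_add (ha : 0 < a) (hσ : σ = a / (1 + a)) : σ < 1 := by
  rw [hσ, div_lt_one (by linarith)]
  linarith

lemma one_sub_one_div_le_rpow (ha0 : 0 < a) (ha1 : a ≤ 1) {s c : ℝ} (hs : 0 < s) (hc : 0 < c)
    (hcs : c ≤ s / a + 1) : 1 - 1 / c ≤ (s / (s + 1)) ^ a := by
  have hbernoulli : (1 + 1 / s) ^ a ≤ 1 + a * (1 / s) :=
    rpow_one_add_le_one_add_mul_self (by linarith [one_div_pos.2 hs]) ha0.le ha1
  calc 1 - 1 / c ≤ 1 - 1 / (s / a + 1) := by gcongr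
    _ = (1 + a * (1 / s))⁻¹ := by
      field_simp
      ring
    _ ≤ ((1 + 1 / s) ^ a)⁻¹ := by gcongr
    _ = (s / (s + 1)) ^ a := by
      rw [← Real.inv_rpow (by positivity)]
      congr 1
      field_simp

lemma paretoAlg_real_missed_le (ha0 : 0 < a) (ha1 : a ≤ 1) (hσ : σ = a / (1 + a)) {M t x : ℕ}
    (ht : t ≤ M) (hx : x ∈ Finset.Icc 1 M) :
    (paretoAlg σ M).real (missed x t) ≤ ((σ * x + 1) / (t + 1)) ^ a := by
  have hσ0 := pos_of_eq_div_one_add ha0 hσ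
  have hσ1 := lt_one_of_eq_div_one_add ha0 hσ
  have htrivial {n : ℕ} (hn : (n : ℝ) ≤ σ * x) :
      (paretoAlg σ M).real (missed x n) ≤ ((σ * x + 1) / (n + 1)) ^ a := by
    refine measureReal_le_one.trans (Real.one_le_rpow ?_ ha0.le)
    rw [one_le_div (by positivity)]
    linarith
  induction t with
  | zero => exact htrivial (by rw [Nat.cast_zero]; positivity)
  | succ t ih =>
    rcases le_or_gt (((t + 1 : ℕ) : ℝ)) (σ * x) with hxt | hxt
    · exact htrivial hxt
    push_cast at hxt ⊢
    have hlt : (t : ℝ) < window σ M (t + 1) := by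
      exact_mod_cast lt_window_succ hσ0 hσ1.le ht
    have hwindow : (window σ M (t + 1) : ℝ) - t ≤ (t + 1) / a + 1 := by
      have hle : (window σ M (t + 1) : ℝ) ≤ (t + 1) / σ := by
        refine (Nat.cast_le.2 (min_le_right _ _)).trans ?_
        exact_mod_cast Nat.floor_le (show 0 ≤ ((t + 1 : ℕ) : ℝ) / σ by positivity)
      have hσa : ((t : ℝ) + 1) / σ = (t + 1) / a + 1 + t := by
        rw [hσ]
        field_simp
        ring
      linarith
    rw [paretoAlg_real_missed_succ hσ0 hσ1.le ht (mem_Icc_window_succ hσ0 hx hxt.le)]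
    calc (1 - 1 / ((window σ M (t + 1) : ℝ) - t)) * (paretoAlg σ M).real (missed x t)
        ≤ ((t + 1) / (t + 1 + 1)) ^ a * ((σ * x + 1) / (t + 1)) ^ a := by
          gcongr
          · exact one_sub_one_div_le_rpow ha0 ha1 (by positivity) (sub_pos.2 hlt) hwindow
          · exact ih (by lia)
      _ = ((σ * x + 1) / (t + 1 + 1)) ^ a := by
          rw [← Real.mul_rpow (by positivity) (by positivity)]
          congr 1
          field_simp

lemma floor_mul_natCast_lt (hσ : σ < 1) {M : ℕ} (hM : 1 ≤ M) : ⌊σ * M⌋₊ < M := by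
  rw [Nat.floor_lt' (by lia)]
  exact mul_lt_of_lt_one_left (by exact_mod_cast hM) hσ

/-- The factor of `(M - t) ^ k` in the bound on the missed weight of the Pareto algorithm after
`t ≥ ⌊σ * M⌋₊` steps. -/
def tailCoeff (k : ℕ) (a b σ : ℝ) (M : ℕ) : ℝ :=
  profileSum k a b σ 1 (⌊σ * M⌋₊ + 1) M / (M - ⌊σ * M⌋₊) ^ k

section

variable (k : ℕ) (b : ℝ) {M t : ℕ}

lemma missedWeight_paretoAlg_le_head (ha0 : 0 < a) (ha1 : a ≤ 1) (hσ : σ = a / (1 + a))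
    (ht : t < ⌊σ * M⌋₊) :
    missedWeight k b (paretoAlg σ M) M t ≤ powSum (-b) M + headExcess k a b σ 1 t := by
  have hσ0 := pos_of_eq_div_one_add ha0 hσ
  have hNM : horizon σ (t + 1) ≤ M := horizon_le hσ0 ht
  have htM : t ≤ M := ht.le.trans <| Nat.floor_le_of_le <|
    mul_le_of_le_one_left M.cast_nonneg (lt_one_of_eq_div_one_add ha0 hσ).le
  rw [← sub_le_iff_le_add', headExcess, missedWeight, powSum, profileSum, powSum,
    ← Finset.sum_sub_distrib, ← Finset.sum_sub_distrib]
  calc ∑ x ∈ Finset.Icc 1 M,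
        ((x : ℝ) ^ (-b) * (paretoAlg σ M).real (missed x t) ^ k - (x : ℝ) ^ (-b))
      ≤ ∑ x ∈ Finset.Icc 1 (horizon σ (t + 1)),
        ((x : ℝ) ^ (-b) * (paretoAlg σ M).real (missed x t) ^ k - (x : ℝ) ^ (-b)) := by
        refine Finset.sum_le_sum_of_subset_of_nonpos' (Finset.Icc_subset_Icc_right hNM)
          fun x _ _ => sub_nonpos.2 <| mul_le_of_le_one_right (by positivity)
            (pow_le_one₀ measureReal_nonneg measureReal_le_one)
    _ ≤ ∑ x ∈ Finset.Icc 1 (horizon σ (t + 1)),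
        ((x : ℝ) ^ (-b) * (((σ * x + 1) / (t + 1)) ^ a) ^ k - (x : ℝ) ^ (-b)) := by
        refine Finset.sum_le_sum fun x hx => ?_
        gcongr
        exact paretoAlg_real_missed_le ha0 ha1 hσ htM (Finset.Icc_subset_Icc_right hNM hx)

lemma missedWeight_paretoAlg_mul (hσ0 : 0 < σ) (hσ1 : σ ≤ 1) {s : ℕ} (hs : σ * M ≤ s + 1)
    (hst : s ≤ t) (htM : t ≤ M) :
    missedWeight k b (paretoAlg σ M) M t * (M - s) ^ k =
      missedWeight k b (paretoAlg σ M) M s * (M - t) ^ k := by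
  simp only [missedWeight, Finset.sum_mul, mul_assoc, ← mul_pow]
  refine Finset.sum_congr rfl fun x hx => ?_
  rw [paretoAlg_real_missed_mul hσ0 hσ1 hs hst htM hx]

lemma missedWeight_paretoAlg_le_tail (ha0 : 0 < a) (ha1 : a ≤ 1) (hσ : σ = a / (1 + a))
    (hM : 1 ≤ M) (hst : ⌊σ * M⌋₊ ≤ t) (htM : t ≤ M) :
    missedWeight k b (paretoAlg σ M) M t ≤ tailCoeff k a b σ M * ((M : ℝ) - t) ^ k := by
  have hσ1 := lt_one_of_eq_div_one_add ha0 hσ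
  have hsM : ⌊σ * M⌋₊ < M := floor_mul_natCast_lt hσ1 hM
  have hsM' : 0 < (M : ℝ) - ⌊σ * M⌋₊ := sub_pos.2 (by exact_mod_cast hsM)
  have hmissed : missedWeight k b (paretoAlg σ M) M ⌊σ * M⌋₊ ≤
      profileSum k a b σ 1 (⌊σ * M⌋₊ + 1) M := by
    refine Finset.sum_le_sum fun x hx => ?_
    gcongr
    exact paretoAlg_real_missed_le ha0 ha1 hσ hsM.le hx
  rw [tailCoeff, div_mul_eq_mul_div, le_div_iff₀ (by positivity),
    missedWeight_paretoAlg_mul k b (pos_of_eq_div_one_add ha0 hσ) hσ1.le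
      (Nat.lt_floor_add_one _).le hst htM]
  have : 0 ≤ (M : ℝ) - t := sub_nonneg.2 (by exact_mod_cast htM)
  gcongr

variable {k}

lemma missedWeight_paretoAlg_eq_zero (hk : k ≠ 0) (hσ0 : 0 < σ) (hσ1 : σ < 1) (hMt : M ≤ t) :
    missedWeight k b (paretoAlg σ M) M t = 0 := by
  refine Finset.sum_eq_zero fun x hx => ?_
  obtain ⟨hx1, hxM⟩ := Finset.mem_Icc.1 hx
  have hsM : ⌊σ * M⌋₊ < M := floor_mul_natCast_lt hσ1 (hx1.trans hxM)
  have hsM' : 0 < (M : ℝ) - ⌊σ * M⌋₊ := sub_pos.2 (by exact_mod_cast hsM)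
  have hzero : (paretoAlg σ M).real (missed x M) = 0 := by
    have := paretoAlg_real_missed_mul hσ0 hσ1.le (Nat.lt_floor_add_one _).le hsM.le le_rfl hx
    simpa [hsM'.ne'] using this
  rw [measureReal_mono_null (missed_anti x hMt) hzero, zero_pow hk, mul_zero]

end

end

/-! ### Asymptotics -/

lemma hasPowerGrowth_floor_mul {σ : ℝ} (hσ : 0 ≤ σ) :
    HasPowerGrowth (fun M => (⌊σ * M⌋₊ : ℝ)) 1 σ := by
  simpa using (hasPowerGrowth_natCast.const_mul σ).natFloor one_pos fun M => by positivity

lemma hasPowerGrowth_natCast_succ : HasPowerGrowth (fun t => (t : ℝ) + 1) 1 1 :=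
  hasPowerGrowth_natCast.add_const one_pos 1

lemma hasPowerGrowth_horizon_succ {σ : ℝ} (hσ : 0 ≤ σ) :
    HasPowerGrowth (fun t => (horizon σ (t + 1) : ℝ)) 1 (1 / σ) := by
  have := (hasPowerGrowth_natCast_succ.const_mul σ⁻¹).natFloor one_pos fun t => by positivity
  simpa [horizon, div_eq_inv_mul] using this

section

variable {k : ℕ} {a b σ δ : ℝ}

lemma hasPowerGrowth_profileSum (hab : a * (k - 1) = b) (ha : 0 < a) (hσ : 0 < σ) (hδ : 0 ≤ δ)
    {m : ℕ → ℝ} {u : ℕ → ℕ} {c d : ℝ} (hm : HasPowerGrowth m 1 d) (hd : 0 < d)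
    (hm0 : ∀ n, 0 ≤ m n) (hu : HasPowerGrowth (fun n => (u n : ℝ)) 1 c) (hc : 0 < c) :
    HasPowerGrowth (fun n => profileSum k a b σ δ (m n) (u n)) (1 - b)
      ((σ ^ a) ^ k / (a + 1) * c ^ (a + 1) / (d ^ a) ^ k) := by
  have hlinear : HasPowerGrowth (fun x => σ * (x : ℝ) + δ) 1 σ := by
    simpa using (hasPowerGrowth_natCast.const_mul σ).add_const one_pos δ
  have hterm : HasPowerGrowth (fun x => (x : ℝ) ^ (-b) * ((σ * x + δ) ^ a) ^ k) a
      ((σ ^ a) ^ k) := by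
    convert (hasPowerGrowth_rpow (-b)).mul ((hlinear.rpow hσ a).pow k) using 1
    · linarith
    · rw [one_mul]
  have hsum := (hterm.sum_Icc (by linarith)).comp hu hc
  convert hsum.div ((hm.rpow hd a).pow k) (by positivity) using 1
  · ext n
    rw [profileSum, Finset.sum_div]
    refine Finset.sum_congr rfl fun x _ => ?_
    rw [Real.div_rpow (by positivity) (hm0 n), div_pow, mul_div_assoc]
  · linarith

lemma hasPowerGrowth_profileSum_horizon (hab : a * (k - 1) = b) (ha : 0 < a) (hσ : 0 < σ)
    (hδ : 0 ≤ δ) :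
    HasPowerGrowth (fun t => profileSum k a b σ δ (t + 1) (horizon σ (t + 1))) (1 - b)
      (1 / (a + 1) * (1 / σ) ^ (1 - b)) := by
  convert hasPowerGrowth_profileSum hab ha hσ hδ hasPowerGrowth_natCast_succ one_pos
    (fun t => by positivity) (hasPowerGrowth_horizon_succ hσ.le) (by positivity) using 1
  have hexp : (1 : ℝ) - b = (a + 1) - a * k := by linarith
  rw [Real.one_rpow, one_pow, div_one, hexp, Real.rpow_sub (by positivity), one_div σ,
    Real.inv_rpow hσ.le (a * k), Real.rpow_mul_natCast hσ.le]
  field_simp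

lemma hasPowerGrowth_headExcess (hab : a * (k - 1) = b) (ha : 0 < a) (hb : b < 1) (hσ : 0 < σ)
    (hδ : 0 ≤ δ) :
    HasPowerGrowth (headExcess k a b σ δ) (1 - b)
      ((1 / (a + 1) - 1 / (1 - b)) * (1 / σ) ^ (1 - b)) := by
  have hpowSum := (hasPowerGrowth_powSum (show -1 < -b by linarith)).comp
    (hasPowerGrowth_horizon_succ hσ.le) (by positivity)
  rw [neg_add_eq_sub] at hpowSum
  rw [sub_mul]
  exact (hasPowerGrowth_profileSum_horizon hab ha hσ hδ).sub hpowSum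

/- `σ = a / (1 + a)` is exactly what makes the profile respect the budget to first order. -/
lemma hasPowerGrowth_budgetGap (ha : 0 < a) (hσ : σ = a / (1 + a)) :
    HasPowerGrowth (budgetGap a σ) 1 0 := by
  have hσ0 := pos_of_eq_div_one_add ha hσ
  have hsum : HasPowerGrowth
      (fun t => profileSum 1 a 0 σ 0 (t + 1) (horizon σ (t + 1))) 1 (1 / (a + 1) * (1 / σ)) := by
    simpa using hasPowerGrowth_profileSum_horizon (k := 1) (b := 0) (δ := 0) (by simp) ha hσ0 le_rfl
  convert ((hasPowerGrowth_horizon_succ hσ0.le).sub hsum).sub hasPowerGrowth_natCast using 1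
  · ext t
    simp [budgetGap, profileSum]
  · rw [hσ]
    field_simp
    ring

lemma hasPowerGrowth_lowerHead (hab : a * (k - 1) = b) (ha : 0 < a) (hb : b < 1)
    (hσ : σ = a / (1 + a)) :
    HasPowerGrowth
      (fun t => headExcess k a b σ 0 t + k * (σ / (t + 1)) ^ b * budgetGap a σ t) (1 - b)
      ((1 / (a + 1) - 1 / (1 - b)) * (1 / σ) ^ (1 - b)) := by
  have hσ0 := pos_of_eq_div_one_add ha hσ
  have hratio : HasPowerGrowth (fun t => σ / ((t : ℝ) + 1)) (-1) σ := by
    simpa using (hasPowerGrowth_const σ).div hasPowerGrowth_natCast_succ one_ne_zero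
  have hcorrection := ((hratio.rpow hσ0 b).const_mul k).mul (hasPowerGrowth_budgetGap ha hσ)
  rw [neg_one_mul, neg_add_eq_sub, mul_zero] at hcorrection
  simpa using (hasPowerGrowth_headExcess hab ha hb hσ0 le_rfl).add hcorrection

lemma hasPowerGrowth_inv_powSum_pow (hk : 1 ≤ k) (hab : a * (k - 1) = b) (ha : 0 < a) :
    HasPowerGrowth (fun M => (powSum a M ^ (k - 1))⁻¹) (1 - b - k) ((1 + a) ^ (k - 1)) := by
  have hpow := (hasPowerGrowth_powSum (show -1 < a by linarith)).pow (k - 1)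
  convert (hasPowerGrowth_const 1).div hpow (by positivity) using 1
  · ext M
    rw [one_div]
  · rw [Nat.cast_pred hk]
    linarith
  · rw [one_div, one_div, inv_pow, inv_inv, add_comm]

lemma hasPowerGrowth_sub_floor_mul (hσ : 0 ≤ σ) :
    HasPowerGrowth (fun M => (M : ℝ) - ⌊σ * M⌋₊) 1 (1 - σ) :=
  hasPowerGrowth_natCast.sub (hasPowerGrowth_floor_mul hσ)

lemma hasPowerGrowth_tailCoeff (hk : 1 ≤ k) (hab : a * (k - 1) = b) (ha : 0 < a)
    (hσ : σ = a / (1 + a)) :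
    HasPowerGrowth (tailCoeff k a b σ) (1 - b - k) ((1 + a) ^ (k - 1)) := by
  have hσ0 := pos_of_eq_div_one_add ha hσ
  have hσ1 : 1 - σ = (1 + a)⁻¹ := by
    rw [hσ]
    field_simp
    ring
  have hprofile := hasPowerGrowth_profileSum (δ := 1) (u := fun M => M) hab ha hσ0 zero_le_one
    ((hasPowerGrowth_floor_mul hσ0.le).add_const one_pos 1) hσ0 (fun M => by positivity)
    hasPowerGrowth_natCast one_pos
  convert hprofile.div ((hasPowerGrowth_sub_floor_mul hσ0.le).pow k)
    (by rw [hσ1]; positivity) using 1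
  · rfl
  · ring
  · rw [hσ1, Real.one_rpow, ← pow_sub_one_mul (by lia : k ≠ 0) (1 + a)⁻¹, inv_pow]
    field_simp
    ring

end

/-- A function of the step `t` with a head, where the searchers have not yet reached box `M`, and
a tail, where they have. Both the lower and the upper bound on `missedWeight` have this shape. -/
def phaseBound (k : ℕ) (b σ : ℝ) (B C : ℕ → ℝ) (M t : ℕ) : ℝ :=
  if t < ⌊σ * M⌋₊ then powSum (-b) M + B t else C M * ((M : ℝ) - t) ^ k

section

variable {k : ℕ} {a b σ : ℝ} {B C : ℕ → ℝ}

lemma sum_Ico_sub_pow (k : ℕ) {s M : ℕ} (hs : s ≤ M) :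
    ∑ t ∈ Finset.Ico s M, ((M : ℝ) - t) ^ k = powSum k (M - s) := by
  have hreflect := Finset.sum_Ico_reflect (fun j => (j : ℝ) ^ k) s (Nat.le_succ M)
  simp only [powSum, Real.rpow_natCast]
  rw [← Finset.Ico_add_one_right_eq_Icc, show M - s + 1 = M + 1 - s by lia]
  rw [Nat.add_sub_cancel_left] at hreflect
  rw [← hreflect]
  refine Finset.sum_congr rfl fun t ht => ?_
  rw [Nat.cast_sub (Finset.mem_Ico.1 ht).2.le]

lemma sum_phaseBound (k : ℕ) (b : ℝ) (B C : ℕ → ℝ) (hσ : σ ≤ 1) (M : ℕ) :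
    ∑ t ∈ Finset.range M, phaseBound k b σ B C M t =
      ⌊σ * M⌋₊ * powSum (-b) M + ∑ t ∈ Finset.range ⌊σ * M⌋₊, B t +
        C M * powSum k (M - ⌊σ * M⌋₊) := by
  have hsM : ⌊σ * M⌋₊ ≤ M := Nat.floor_le_of_le (mul_le_of_le_one_left M.cast_nonneg hσ)
  rw [← Finset.sum_range_add_sum_Ico _ hsM]
  simp only [phaseBound]
  congr 1
  · rw [Finset.sum_congr rfl fun t ht => if_pos (Finset.mem_range.1 ht), Finset.sum_add_distrib]
    simp
  · rw [Finset.sum_congr rfl fun t ht => if_neg (Finset.mem_Ico.1 ht).1.not_gt, ← Finset.mul_sum,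
      sum_Ico_sub_pow k hsM]

lemma hasPowerGrowth_sum_phaseBound {β γ : ℝ} (hb : b < 1) (hσ0 : 0 < σ) (hσ1 : σ < 1)
    (hB : HasPowerGrowth B (1 - b) β) (hC : HasPowerGrowth C (1 - b - k) γ) :
    HasPowerGrowth (fun M => ∑ t ∈ Finset.range M, phaseBound k b σ B C M t) (2 - b)
      (σ / (1 - b) + β / (2 - b) * σ ^ (2 - b) + γ * ((1 - σ) ^ (k + 1) / (k + 1))) := by
  have hfloor : HasPowerGrowth (fun M => (⌊σ * M⌋₊ : ℝ)) 1 σ := hasPowerGrowth_floor_mul hσ0.le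
  have hfull : HasPowerGrowth (fun M => ⌊σ * M⌋₊ * powSum (-b) M) (2 - b) (σ / (1 - b)) := by
    convert hfloor.mul (hasPowerGrowth_powSum (show -1 < -b by linarith)) using 1 <;> ring
  have hhead : HasPowerGrowth (fun M => ∑ t ∈ Finset.range ⌊σ * M⌋₊, B t) (2 - b)
      (β / (2 - b) * σ ^ (2 - b)) := by
    have hsum := hB.sum_range (by linarith)
    rw [show 1 - b + 1 = 2 - b by ring] at hsum
    exact hsum.comp hfloor hσ0
  have hrest : HasPowerGrowth (fun M => ((M - ⌊σ * M⌋₊ : ℕ) : ℝ)) 1 (1 - σ) := by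
    refine (hasPowerGrowth_sub_floor_mul hσ0.le).congr' (Eventually.of_forall fun M => ?_)
    dsimp only
    rw [Nat.cast_sub (Nat.floor_le_of_le (mul_le_of_le_one_left M.cast_nonneg hσ1.le))]
  have htail : HasPowerGrowth (fun M => C M * powSum k (M - ⌊σ * M⌋₊)) (2 - b)
      (γ * ((1 - σ) ^ (k + 1) / (k + 1))) := by
    have hk : (-1 : ℝ) < k := by linarith [(k.cast_nonneg : (0 : ℝ) ≤ k)]
    convert hC.mul ((hasPowerGrowth_powSum hk).comp hrest (sub_pos.2 hσ1)) using 1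
    · ring
    · rw [← Nat.cast_add_one, Real.rpow_natCast]
      ring
  simp only [sum_phaseBound k b B C hσ1.le]
  exact (hfull.add hhead).add htail

/-- The limit of the ratio of the expected times of the Pareto algorithm and of `cord k`. -/
def limitRatio (k : ℕ) (b σ : ℝ) : ℝ :=
  k * σ * (2 - σ) + (k : ℝ) / (k + 1) * (2 - b) * (1 - σ) ^ 2

lemma hasPowerGrowth_sum_phaseBound_limitRatio (hk : 1 ≤ k) (hb : b < 1) (ha : 0 < a)
    (hσ : σ = a / (1 + a))
    (hB : HasPowerGrowth B (1 - b) ((1 / (a + 1) - 1 / (1 - b)) * (1 / σ) ^ (1 - b)))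
    (hC : HasPowerGrowth C (1 - b - k) ((1 + a) ^ (k - 1))) :
    HasPowerGrowth (fun M => ∑ t ∈ Finset.range M, phaseBound k b σ B C M t) (2 - b)
      (limitRatio k b σ / (k * (2 - b))) := by
  have hσ0 := pos_of_eq_div_one_add ha hσ
  have hσ1 := lt_one_of_eq_div_one_add ha hσ
  convert hasPowerGrowth_sum_phaseBound hb hσ0 hσ1 hB hC using 1
  have hσa : (1 - σ) * (1 + a) = 1 := by
    rw [hσ]
    field_simp
    ring
  have ha' : 1 / (a + 1) = 1 - σ := by
    rw [add_comm, eq_comm]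
    exact eq_one_div_of_mul_eq_one_left hσa
  have hheadPower : (1 / σ) ^ (1 - b) * σ ^ (2 - b) = σ := by
    rw [one_div, Real.inv_rpow hσ0.le, ← Real.rpow_neg hσ0.le, ← Real.rpow_add hσ0]
    norm_num
  have htailPower : (1 + a) ^ (k - 1) * (1 - σ) ^ (k + 1) = (1 - σ) ^ 2 := by
    rw [show k + 1 = k - 1 + 2 by lia, pow_add, ← mul_assoc, ← mul_pow, mul_comm (1 + a), hσa,
      one_pow, one_mul]
  calc limitRatio k b σ / (k * (2 - b))
      = σ / (1 - b) + (1 - σ - 1 / (1 - b)) / (2 - b) * σ + (1 - σ) ^ 2 / (k + 1) := by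
        have : (k : ℝ) ≠ 0 := by exact_mod_cast (by lia : k ≠ 0)
        have : 1 - b ≠ 0 := by linarith
        have : 2 - b ≠ 0 := by linarith
        rw [limitRatio]
        field_simp
        ring
    _ = σ / (1 - b) + (1 - σ - 1 / (1 - b)) / (2 - b) * ((1 / σ) ^ (1 - b) * σ ^ (2 - b)) +
          (1 + a) ^ (k - 1) * (1 - σ) ^ (k + 1) / (k + 1) := by
        rw [hheadPower, htailPower]
    _ = _ := by
        rw [ha']
        ring

end

section

variable {k : ℕ} {b : ℝ}

lemma hasPowerGrowth_sum_cord (hk : 1 ≤ k) (hb : b < 1) :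
    HasPowerGrowth
      (fun M => ∑ x ∈ Finset.Icc 1 M, (x : ℝ) ^ (-b) * ((((x - 1) / k : ℕ) : ℝ) + 1)) (2 - b)
      (1 / (k * (2 - b))) := by
  have hpred : HasPowerGrowth (fun x => ((x - 1 : ℕ) : ℝ)) 1 1 := by
    refine (hasPowerGrowth_natCast.add_const one_pos (-1)).congr' ?_
    filter_upwards [eventually_ge_atTop 1] with x hx
    rw [Nat.cast_pred hx, sub_eq_add_neg]
  have hdiv : HasPowerGrowth (fun x => (((x - 1) / k : ℕ) : ℝ)) 1 (1 / k) := by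
    have := (hpred.const_mul (k : ℝ)⁻¹).natFloor one_pos fun x => by positivity
    simpa [← div_eq_inv_mul, Nat.floor_div_eq_div] using this
  have hterm := (hasPowerGrowth_rpow (-b)).mul (hdiv.add_const one_pos 1)
  convert hterm.sum_Icc (by linarith) using 1
  · ring
  · rw [one_mul, div_div]
    ring

lemma tendsto_ofReal_div_expectedTime_cord (hk : 1 ≤ k) (hb : b < 1) {f : ℕ → ℝ} {L : ℝ}
    (hf : HasPowerGrowth f (2 - b) (L / (k * (2 - b)))) :
    Tendsto (fun M => ENNReal.ofReal (f M) / expectedTime (powerWeight M b) (cord k)) atTop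
      (𝓝 (ENNReal.ofReal L)) := by
  have hb2 : 0 < 2 - b := by linarith
  have hlimit : 0 < 1 / ((k : ℝ) * (2 - b)) := by positivity
  have hcord := hasPowerGrowth_sum_cord hk hb
  have hratio := hf.tendsto_div hcord hlimit.ne'
  rw [one_div, div_inv_eq_mul, div_mul_cancel₀ _ (by positivity)] at hratio
  refine (ENNReal.tendsto_ofReal hratio).congr' ?_
  filter_upwards [hcord.eventually_pos hlimit] with M hM
  rw [expectedTime_powerWeight_cord hk, ENNReal.ofReal_div_of_pos hM]

end

section

variable {k M : ℕ} {a b σ : ℝ}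

lemma ofReal_sum_phaseBound_le_expectedTime (hk : 1 ≤ k) (hab : a * (k - 1) = b) (hb : 0 ≤ b)
    (hσ : 0 < σ) (A : Measure (ℕ → ℕ)) [IsProbabilityMeasure A] (M : ℕ) :
    ENNReal.ofReal (∑ t ∈ Finset.range M, phaseBound k b σ
        (fun t => headExcess k a b σ 0 t + k * (σ / (t + 1)) ^ b * budgetGap a σ t)
        (fun M => (powSum a M ^ (k - 1))⁻¹) M t) ≤
      expectedTime (powerWeight M b) (nonCoordinating k A) := by
  refine ofReal_sum_le_expectedTime fun t ht => ?_
  unfold phaseBound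
  split_ifs with hhead
  · exact powSum_add_headExcess_le_missedWeight hk hab hb hσ A hhead
  · exact mul_sub_pow_le_missedWeight hk hab A ht

lemma expectedTime_paretoAlg_le_ofReal_sum_phaseBound (hk : 1 ≤ k) (b : ℝ) (ha0 : 0 < a)
    (ha1 : a ≤ 1) (hσ : σ = a / (1 + a)) (hM : 1 ≤ M) :
    expectedTime (powerWeight M b) (nonCoordinating k (paretoAlg σ M)) ≤
      ENNReal.ofReal (∑ t ∈ Finset.range M,
        phaseBound k b σ (headExcess k a b σ 1) (tailCoeff k a b σ) M t) := by
  refine expectedTime_le_ofReal_sum (fun t ht => ?_) fun t hMt =>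
    missedWeight_paretoAlg_eq_zero b (by lia) (pos_of_eq_div_one_add ha0 hσ)
      (lt_one_of_eq_div_one_add ha0 hσ) hMt
  unfold phaseBound
  split_ifs with hhead
  · exact missedWeight_paretoAlg_le_head k b ha0 ha1 hσ hhead
  · exact missedWeight_paretoAlg_le_tail k b ha0 ha1 hσ hM (not_lt.1 hhead) ht.le

theorem limitRatio_le_liminf_expectedTime_div (hk : 1 ≤ k) (hab : a * (k - 1) = b) (ha : 0 < a)
    (hb0 : 0 ≤ b) (hb1 : b < 1) (hσ : σ = a / (1 + a)) (A : ℕ → Measure (ℕ → ℕ))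
    (hA : ∀ M, IsProbabilityMeasure (A M)) :
    ENNReal.ofReal (limitRatio k b σ) ≤
      liminf (fun M : ℕ => expectedTime (paretoDist M b) (nonCoordinating k (A M)) /
        expectedTime (paretoDist M b) (cord k)) atTop := by
  have hbound := tendsto_ofReal_div_expectedTime_cord hk hb1 <|
    hasPowerGrowth_sum_phaseBound_limitRatio hk hb1 ha hσ
      (hasPowerGrowth_lowerHead hab ha hb1 hσ) (hasPowerGrowth_inv_powSum_pow hk hab ha)
  rw [← hbound.liminf_eq]
  refine liminf_le_liminf ?_
  filter_upwards [eventually_ge_atTop 1] with M hM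
  rw [expectedTime_paretoDist_div hM]
  exact ENNReal.div_le_div_right (ofReal_sum_phaseBound_le_expectedTime hk hab hb0
    (pos_of_eq_div_one_add ha hσ) (A M) M) _

theorem limsup_expectedTime_paretoAlg_div_le (hk : 1 ≤ k) (hab : a * (k - 1) = b) (ha0 : 0 < a)
    (ha1 : a ≤ 1) (hb : b < 1) (hσ : σ = a / (1 + a)) :
    limsup (fun M : ℕ => expectedTime (paretoDist M b) (nonCoordinating k (paretoAlg σ M)) /
        expectedTime (paretoDist M b) (cord k)) atTop ≤ ENNReal.ofReal (limitRatio k b σ) := by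
  have hbound := tendsto_ofReal_div_expectedTime_cord hk hb <|
    hasPowerGrowth_sum_phaseBound_limitRatio hk hb ha0 hσ
      (hasPowerGrowth_headExcess hab ha0 hb (pos_of_eq_div_one_add ha0 hσ) zero_le_one)
      (hasPowerGrowth_tailCoeff hk hab ha0 hσ)
  rw [← hbound.limsup_eq]
  refine limsup_le_limsup ?_
  filter_upwards [eventually_ge_atTop 1] with M hM
  rw [expectedTime_paretoDist_div hM]
  exact ENNReal.div_le_div_right
    (expectedTime_paretoAlg_le_ofReal_sum_phaseBound hk b ha0 ha1 hσ hM) _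

end

end ParallelSearch

end

theorem mainTheorem1 (k : ℕ) (hk : 2 ≤ k) (b : ℝ) (hb0 : 0 < b) (hb1 : b < 1)
    (σ : ℝ) (hσ : σ = b / (b + k - 1)) :
    Tendsto
      (fun M : ℕ =>
        ParallelSearch.expectedTime (ParallelSearch.paretoDist M b)
            (ParallelSearch.nonCoordinating k (ParallelSearch.paretoAlg σ M)) /
          ParallelSearch.expectedTime (ParallelSearch.paretoDist M b) (ParallelSearch.cord k))
      atTop
      (𝓝 (ENNReal.ofReal
        (k * σ * (2 - σ) + (k : ℝ) / (k + 1) * (2 - b) * (1 - σ) ^ 2))) ∧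
    ∀ A : ℕ → Measure (ℕ → ℕ), (∀ M, IsProbabilityMeasure (A M)) →
      ENNReal.ofReal (k * σ * (2 - σ) + (k : ℝ) / (k + 1) * (2 - b) * (1 - σ) ^ 2) ≤
        liminf
          (fun M : ℕ =>
            ParallelSearch.expectedTime (ParallelSearch.paretoDist M b)
                (ParallelSearch.nonCoordinating k (A M)) /
              ParallelSearch.expectedTime (ParallelSearch.paretoDist M b)
                (ParallelSearch.cord k))
          atTop := by
  have hk2 : (2 : ℝ) ≤ k := by exact_mod_cast hk
  have hk1 : 0 < (k : ℝ) - 1 := by linarith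
  obtain ⟨a, ha⟩ : ∃ a : ℝ, a = b / (k - 1) := ⟨_, rfl⟩
  have hab : a * (k - 1) = b := by rw [ha, div_mul_cancel₀ _ hk1.ne']
  have ha0 : 0 < a := by rw [ha]; positivity
  have ha1 : a ≤ 1 := by rw [ha, div_le_one hk1]; linarith
  have hσa : σ = a / (1 + a) := by
    rw [hσ, ha, one_add_div hk1.ne', div_div_div_cancel_right₀ hk1.ne', add_sub_assoc, add_comm b]
  have hlower :=
    ParallelSearch.limitRatio_le_liminf_expectedTime_div (by lia) hab ha0 hb0.le hb1 hσa
  have hupper :=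
    ParallelSearch.limsup_expectedTime_paretoAlg_div_le (by lia) hab ha0 ha1 hb1 hσa
  exact ⟨tendsto_of_le_liminf_of_limsup_le (hlower _ fun _ => inferInstance) hupper, hlower⟩
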